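/- Let $\mathcal X,\mathcal Y$ be measurable spaces, let $\mathcal A$ be a finite set of actions, and let $\mathcal H$ be a separable real reproducing kernel Hilbert space of functions on $\mathcal Y$ with kernel $K$ and measurable feature map $\phi(y)=K(y,\cdot)$. Let $R_1,R_2,\beta>0$ and assume $\|\phi(y)\|_{\mathcal H}\le R_2$ for all $y$. Let $$\mathcal L_{\mathcal H}=\{\ell:\mathcal A\times\mathcal Y\to\mathbb R \;:\; \ell(a,\cdot)\in\mathcal H,\ \|\ell(a,\cdot)\|_{\mathcal H}\le R_1\ \text{ for all } a\in\mathcal A\},$$ and write $r_\ell(a)=\ell(a,\cdot)\in\mathcal H$. Let $p:\mathcal X\to\mathcal H$ be any measurable predictor with $\|p(x)\|_{\mathcal H}\le R_2$ for all $x$. Its loss estimator is $f_p(x,a,\ell)=\langle r_\ell(a),p(x)\rangle_{\mathcal H}$, the smoothed (softmax, quantal response) decision rule is $$\tilde k_{f_p,\ell}(x,a)=\frac{e^{-\beta f_p(x,a,\ell)}}{\sum_{a'\in\mathcal A}e^{-\beta f_p(x,a',\ell)}},$$ and for $\ell,\ell'\in\mathcal L_{\mathcal H}$ the decision-calibration gap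 function is $$g_{\ell,\ell'}(x,y)=\sum_{a\in\mathcal A}\langle r_\ell(a),\phi(y)-p(x)\rangle_{\mathcal H}\,\tilde k_{f_p,\ell'}(x,a).$$ Theorem. For every $c>0$ there is a constant $C>0$, depending only on $c$, such that the following holds for all $\mathcal X,\mathcal Y,\mathcal A,\mathcal H,R_1,R_2,\beta,p$ as above, every probability distribution $\mathcal D$ on $\mathcal X\times\mathcal Y$, every $n\in\mathbb N$ and every $\delta\in(0,1)$, provided that $\beta R_1R_2\ge c$, $\beta^2R_1R_2\ge c$ and $R_1R_2n\ge 1+c$. If $(x_1,y_1),\dots,(x_n,y_n)$ are drawn i.i.d. from $\mathcal D$, then with probability at least $1-\delta$, simultaneously for all $\ell,\ell'\in\mathcal L_{\mathcal H}$, $$\left|\mathbb E_{(x,y)\sim\mathcal D}\big[g_{\ell,\ell'}(x,y)\big]-\frac1n\sum_{i=1}^n g_{\ell,\ell'}(x_i,y_i)\right|\le C\,\frac{|\mathcal A|^{3/2}\beta^2R_1^3R_2^3\log(R_1R_2n)+\log(1/\delta)}{\sqrt n}.$$ In particular the bound does not depend on $\dim\mathcal H$, which may be infinite. -/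

import Mathlib

open MeasureTheory
open scoped InnerProductSpace

namespace DecisionCalibration

noncomputable section

/-- The canonical feature map `φ(y) = K(y, ·)` of a real-valued reproducing kernel Hilbert space `H`
of functions on `Y`. -/
def featureMap {Y : Type*} (H : Type*) [NormedAddCommGroup H] [InnerProductSpace ℝ H]
    [CompleteSpace H] [RKHS ℝ H Y ℝ] (y : Y) : H :=
  RKHS.kerFun H y (1 : ℝ)

/-- The reproducing property `h(y) = ⟨h, φ(y)⟩`. -/
theorem inner_featureMap {Y : Type*} {H : Type*} [NormedAddCommGroup H] [InnerProductSpace ℝ H]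
    [CompleteSpace H] [RKHS ℝ H Y ℝ] (h : H) (y : Y) : ⟪h, featureMap H y⟫_ℝ = h y := by
  simp [featureMap]

/-- The class of loss functions `ℓ : A × Y → ℝ` such that, for every action `a`, the function
`ℓ(a, ·)` belongs to the space `H` and has norm at most `R₁`. A loss function is represented by the
family `a ↦ ℓ(a, ·) ∈ H`, so `ℓ a y` is the loss of action `a` at outcome `y`. -/
def lossClass (A : Type*) (H : Type*) [NormedAddCommGroup H] (R₁ : ℝ) : Set (A → H) :=
  {ℓ | ∀ a, ‖ℓ a‖ ≤ R₁}

/-- The loss estimator `f_p(x, a, ℓ) = ⟨ℓ(a, ·), p(x)⟩` induced by a predictor `p : X → H`. -/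
def lossEstimator {X A H : Type*} [NormedAddCommGroup H] [InnerProductSpace ℝ H]
    (p : X → H) (x : X) (a : A) (ℓ : A → H) : ℝ :=
  ⟪ℓ a, p x⟫_ℝ

/-- The smoothed optimal (quantal response) decision rule with parameter `β` of a decision maker
with loss `ℓ` who relies on the loss estimator `f`: the probability of playing `a` at `x`. -/
def smoothRule {X A L : Type*} [Fintype A] (β : ℝ) (f : X → A → L → ℝ) (ℓ : L) (x : X) (a : A) :
    ℝ :=
  Real.exp (-β * f x a ℓ) / ∑ a', Real.exp (-β * f x a' ℓ)

/-- The decision-calibration gap function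
`g_{ℓ,ℓ'} = ∑ₐ ⟨ℓ(a, ·), φ(y) - p(x)⟩ k̃_{f_p,ℓ'}(x, a)` at the data point `z = (x, y)`. -/
def gap {X Y A H : Type*} [Fintype A] [NormedAddCommGroup H] [InnerProductSpace ℝ H]
    [CompleteSpace H] [RKHS ℝ H Y ℝ] (β : ℝ) (p : X → H) (ℓ ℓ' : A → H) (z : X × Y) : ℝ :=
  ∑ a, ⟪ℓ a, featureMap H z.2 - p z.1⟫_ℝ * smoothRule β (lossEstimator p) ℓ' z.1 a

/-- The empirical expectation of `ψ` over the data set `S` of size `n`. -/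
def empiricalMean {Z : Type*} {n : ℕ} (S : Fin n → Z) (ψ : Z → ℝ) : ℝ :=
  (1 / (n : ℝ)) * ∑ i, ψ (S i)

end

end DecisionCalibration

/-! At a data point, the gap depends on the two losses only through 2|A| real numbers that are
linear in them: ⟨ℓ_a, φ(y) - p(x)⟩ and ⟨ℓ'_a, p(x)⟩. As a function of these numbers it is Lipschitz
for the sup norm with constant L = 1 + 8βR₁R₂ (`abs_sum_mul_softmax_sub_le`), because softmax is
4β-Lipschitz from sup norm to ℓ¹. A vector contraction principle (`expect_iSup_le_expect_iSup`) then
bounds the Rademacher average of the gaps by that of L times the linear features, each carrying its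
own independent sign. No constant is lost, since max_k |d_k| ≤ 𝔼|∑ η_k d_k|.

For linear features, the supremum over a ball of radius R₁ is at most R₁‖∑ ε_i w_i‖, and
orthogonality of signs in a Hilbert space bounds the mean of this by R₁W√n when ‖w_i‖ ≤ W
(`expect_norm_sum_le`). The dimension never enters.

Symmetrization converts this into a bound on the expected uniform deviation, and McDiarmid's
inequality into one with high probability. Both are run on finite subfamilies, where suprema are
attained and measurable; continuity in the losses and separability of H extend the result to the
whole class.

With M = R₁R₂ the deviation obtained is of order ((1 + βM)|A|M + M√log(1/δ))/√n. No covering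
argument is used, so |A|^(3/2) and log(Mn) appear only when this is weakened to the stated form
(`deviation_arithmetic`). -/

namespace DecisionCalibration

open scoped BigOperators

/-! ### Orthogonality of Rademacher signs -/

section Signs

/-- Two functions of distinct coordinates are uncorrelated under the uniform distribution on
`ι → G` if one of them is odd under a translation of `G`. -/
theorem expect_mul_eq_zero_of_odd {ι G : Type*} [Fintype ι] [DecidableEq ι] [Group G] [Fintype G]
    (f h : G → ℝ) (g : G) (hf : ∀ x, f (g * x) = -f x) {i j : ι} (hij : i ≠ j) :
    𝔼 ε : ι → G, f (ε i) * h (ε j) = 0 := by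
  have key : 𝔼 ε : ι → G, f (ε i) * h (ε j) = 𝔼 ε : ι → G, -(f (ε i) * h (ε j)) := by
    refine Fintype.expect_equiv (Equiv.mulLeft (Pi.mulSingle i g⁻¹)) _ _ fun ε => ?_
    have hfi : f (g⁻¹ * ε i) = -f (ε i) := by
      have := hf (g⁻¹ * ε i)
      rw [mul_inv_cancel_left] at this
      linarith
    simp [Pi.mulSingle_eq_of_ne hij.symm, hfi]
  rw [Finset.expect_neg_distrib] at key
  linarith

theorem intUnits_sq (u : ℤˣ) : ((u : ℤ) : ℝ) * ((u : ℤ) : ℝ) = 1 := by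
  rcases Int.units_eq_one_or u with rfl | rfl <;> simp

theorem abs_intUnits (u : ℤˣ) : |((u : ℤ) : ℝ)| = 1 := by
  rcases Int.units_eq_one_or u with rfl | rfl <;> simp

/-- Each coefficient is at most the mean absolute value of the Rademacher sum. -/
theorem abs_le_expect_abs_sum {K : Type*} [Fintype K] [DecidableEq K] (d : K → ℝ) (k : K) :
    |d k| ≤ 𝔼 η : K → ℤˣ, |∑ j, ((η j : ℤ) : ℝ) * d j| := by
  -- Testing the sum against the sign η k isolates the coefficient d k.
  have h1 : 𝔼 η : K → ℤˣ, ((η k : ℤ) : ℝ) * ∑ j, ((η j : ℤ) : ℝ) * d j = d k := by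
    simp_rw [Finset.mul_sum]
    rw [Finset.expect_sum_comm, Finset.sum_eq_single k]
    · simp_rw [← mul_assoc, intUnits_sq, one_mul]
      exact Fintype.expect_const _
    · intro j _ hj
      simp_rw [← mul_assoc]
      rw [← Finset.expect_mul, expect_mul_eq_zero_of_odd (fun u : ℤˣ => ((u : ℤ) : ℝ))
        (fun u : ℤˣ => ((u : ℤ) : ℝ)) (-1) (by simp) hj.symm, zero_mul]
    · simp
  calc |d k| = |𝔼 η : K → ℤˣ, ((η k : ℤ) : ℝ) * ∑ j, ((η j : ℤ) : ℝ) * d j| := by rw [h1]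
    _ ≤ 𝔼 η : K → ℤˣ, |((η k : ℤ) : ℝ) * ∑ j, ((η j : ℤ) : ℝ) * d j| := Finset.abs_expect_le _ _
    _ = _ := by simp_rw [abs_mul, abs_intUnits, one_mul]

/-- The mean norm of a Rademacher sum of `n` vectors of norm at most `W` is at most `√n * W`. -/
theorem expect_norm_sum_le {K H : Type*} [Fintype K] [DecidableEq K] [NormedAddCommGroup H]
    [InnerProductSpace ℝ H] {n : ℕ} (w : Fin n → H) {W : ℝ} (hW : 0 ≤ W) (hw : ∀ i, ‖w i‖ ≤ W)
    (k : K) :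
    𝔼 η : Fin n → K → ℤˣ, ‖∑ i, ((η i k : ℤ) : ℝ) • w i‖ ≤ √n * W := by
  have hsq : 𝔼 η : Fin n → K → ℤˣ, ‖∑ i, ((η i k : ℤ) : ℝ) • w i‖ ^ 2 = ∑ i, ‖w i‖ ^ 2 := by
    have h (η : Fin n → K → ℤˣ) : ‖∑ i, ((η i k : ℤ) : ℝ) • w i‖ ^ 2
        = ∑ i, ∑ j, ((η i k : ℤ) : ℝ) * ((η j k : ℤ) : ℝ) * ⟪w i, w j⟫_ℝ := by
      rw [← real_inner_self_eq_norm_sq, sum_inner]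
      refine Finset.sum_congr rfl fun i _ => ?_
      rw [inner_sum]
      refine Finset.sum_congr rfl fun j _ => ?_
      rw [real_inner_smul_left, real_inner_smul_right]
      ring
    simp_rw [h]
    rw [Finset.expect_sum_comm]
    refine Finset.sum_congr rfl fun i _ => ?_
    rw [Finset.expect_sum_comm, Finset.sum_eq_single i]
    · simp_rw [intUnits_sq, one_mul, real_inner_self_eq_norm_sq]
      exact Fintype.expect_const _
    · intro j _ hj
      -- The independent coordinates are now whole sign vectors in K → ℤˣ; reading off entry k is
      -- odd under multiplication by -1.
      rw [← Finset.expect_mul, expect_mul_eq_zero_of_odd (fun u : K → ℤˣ => ((u k : ℤ) : ℝ))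
        (fun u : K → ℤˣ => ((u k : ℤ) : ℝ)) (-1) (by simp) hj.symm, zero_mul]
    · simp
  have hle : (𝔼 η : Fin n → K → ℤˣ, ‖∑ i, ((η i k : ℤ) : ℝ) • w i‖) ^ 2 ≤ n * W ^ 2 := by
    calc (𝔼 η : Fin n → K → ℤˣ, ‖∑ i, ((η i k : ℤ) : ℝ) • w i‖) ^ 2
        ≤ 𝔼 η : Fin n → K → ℤˣ, ‖∑ i, ((η i k : ℤ) : ℝ) • w i‖ ^ 2 := by
          have := Finset.expect_mul_sq_le_sq_mul_sq Finset.univ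
            (fun η : Fin n → K → ℤˣ => ‖∑ i, ((η i k : ℤ) : ℝ) • w i‖) fun _ => 1
          simpa [Fintype.expect_const] using this
      _ = ∑ i, ‖w i‖ ^ 2 := hsq
      _ ≤ ∑ _i : Fin n, W ^ 2 := Finset.sum_le_sum fun i _ => by
          have := hw i
          gcongr
      _ = n * W ^ 2 := by simp
  calc _ ≤ √(n * W ^ 2) := Real.le_sqrt_of_sq_le hle
    _ = √n * W := by rw [Real.sqrt_mul (by positivity), Real.sqrt_sq hW]

end Signs

/-! ### Contraction principle with vector-valued signs -/

section Contraction

theorem le_ciSup_finite {T : Type*} [Finite T] (f : T → ℝ) (t : T) : f t ≤ ⨆ t, f t :=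
  le_ciSup (Set.finite_range f).bddAbove t

variable {T : Type*} [Finite T] [Nonempty T]

/-- One step of the contraction principle: a Rademacher sign in front of a real function is replaced
by a Rademacher combination of functions that dominates its increments coordinatewise. -/
theorem iSup_add_iSup_le_expect {K : Type*} [Fintype K] [DecidableEq K] (F a : T → ℝ)
    (b : K → T → ℝ)
    (hab : ∀ t t' m, (∀ k, |b k t - b k t'| ≤ m) → 0 ≤ m → |a t - a t'| ≤ m) :
    ((⨆ t, F t + a t) + ⨆ t, F t - a t) / 2
      ≤ 𝔼 η : K → ℤˣ, ⨆ t, F t + ∑ k, ((η k : ℤ) : ℝ) * b k t := by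
  obtain ⟨t, ht⟩ := exists_eq_ciSup_of_finite (f := fun t => F t + a t)
  obtain ⟨t', ht'⟩ := exists_eq_ciSup_of_finite (f := fun t => F t - a t)
  rw [← ht, ← ht']
  set d : K → ℝ := fun k => b k t - b k t' with hd
  -- The common bound m on the coordinates of d is taken to be the mean of |∑ η_j d_j|, not their
  -- maximum.
  have hm : |a t - a t'| ≤ 𝔼 η : K → ℤˣ, |∑ j, ((η j : ℤ) : ℝ) * d j| :=
    hab _ _ _ (fun k => abs_le_expect_abs_sum d k) (Finset.expect_nonneg fun _ _ => abs_nonneg _)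
  have hneg : 𝔼 η : K → ℤˣ, (⨆ t, F t + ∑ k, ((η k : ℤ) : ℝ) * b k t)
      = 𝔼 η : K → ℤˣ, ⨆ t, F t - ∑ k, ((η k : ℤ) : ℝ) * b k t := by
    refine Fintype.expect_equiv (Equiv.mulLeft (-1 : K → ℤˣ)) _ _ fun ε => ?_
    simp
  -- The sign of ∑ η_j d_j decides which of t, t' is inserted in which of the two suprema.
  have hpt (η : K → ℤˣ) : F t + F t' + |∑ j, ((η j : ℤ) : ℝ) * d j|
      ≤ (⨆ t, F t + ∑ k, ((η k : ℤ) : ℝ) * b k t)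
        + ⨆ t, F t - ∑ k, ((η k : ℤ) : ℝ) * b k t := by
    have e : ∑ j, ((η j : ℤ) : ℝ) * d j
        = ∑ k, ((η k : ℤ) : ℝ) * b k t - ∑ k, ((η k : ℤ) : ℝ) * b k t' := by
      simp [hd, mul_sub]
    have h1 := le_ciSup_finite (fun t => F t + ∑ k, ((η k : ℤ) : ℝ) * b k t) t
    have h2 := le_ciSup_finite (fun t => F t + ∑ k, ((η k : ℤ) : ℝ) * b k t) t'
    have h3 := le_ciSup_finite (fun t => F t - ∑ k, ((η k : ℤ) : ℝ) * b k t) t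
    have h4 := le_ciSup_finite (fun t => F t - ∑ k, ((η k : ℤ) : ℝ) * b k t) t'
    rcases abs_cases (∑ j, ((η j : ℤ) : ℝ) * d j) with ⟨h, -⟩ | ⟨h, -⟩ <;> rw [h, e] <;> linarith
  have hsum := Finset.expect_le_expect (s := (Finset.univ : Finset (K → ℤˣ))) fun η _ => hpt η
  rw [Finset.expect_add_distrib, Fintype.expect_const, Finset.expect_add_distrib, ← hneg] at hsum
  have := le_abs_self (a t - a t')
  linarith

theorem expect_fin_succ {G : Type*} [Fintype G] {n : ℕ} (f : (Fin (n + 1) → G) → ℝ) :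
    𝔼 ε, f ε = 𝔼 x : G, 𝔼 ε : Fin n → G, f (Fin.cons x ε) := by
  rw [← Finset.expect_product', Finset.univ_product_univ]
  exact Fintype.expect_equiv (Fin.consEquiv fun _ => G).symm _ _ fun ε => by
    simp [Fin.consEquiv]

theorem expect_intUnits (f : ℤˣ → ℝ) : 𝔼 u : ℤˣ, f u = (f 1 + f (-1)) / 2 := by
  rw [Fintype.expect_eq_sum_div_card]
  have : (Finset.univ : Finset ℤˣ) = {1, -1} := rfl
  rw [this, Finset.sum_pair (by decide)]
  simp

/-- Contraction principle for Rademacher averages: if each function `a i` is dominated in its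
increments by the family `b i`, the Rademacher average of `a` is at most that of `b`. -/
theorem expect_iSup_le_expect_iSup {K : Type*} [Fintype K] [DecidableEq K] :
    ∀ (n : ℕ) (F : T → ℝ) (a : Fin n → T → ℝ) (b : Fin n → K → T → ℝ),
      (∀ i t t' m, (∀ k, |b i k t - b i k t'| ≤ m) → 0 ≤ m → |a i t - a i t'| ≤ m) →
      𝔼 ε : Fin n → ℤˣ, (⨆ t, F t + ∑ i, ((ε i : ℤ) : ℝ) * a i t)
        ≤ 𝔼 η : Fin n → K → ℤˣ, ⨆ t, F t + ∑ i, ∑ k, ((η i k : ℤ) : ℝ) * b i k t := by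
  intro n
  -- F remains arbitrary in the induction: it absorbs the terms not being exchanged, first the
  -- remaining a-terms, then the b-term just produced.
  induction n with
  | zero => intro F a b _; simp
  | succ n ih =>
    intro F a b hab
    rw [expect_fin_succ, expect_fin_succ, expect_intUnits]
    simp only [Fin.sum_univ_succ, Fin.cons_zero, Fin.cons_succ]
    calc _ = 𝔼 ε : Fin n → ℤˣ,
          ((⨆ t, (F t + ∑ i : Fin n, ((ε i : ℤ) : ℝ) * a i.succ t) + a 0 t)
            + ⨆ t, (F t + ∑ i : Fin n, ((ε i : ℤ) : ℝ) * a i.succ t) - a 0 t) / 2 := by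
          rw [← Finset.expect_div (K := ℝ), Finset.expect_add_distrib]
          congr 2 <;> refine Finset.expect_congr rfl fun ε _ => ?_ <;>
            refine iSup_congr fun t => ?_ <;> push_cast <;> ring
      _ ≤ 𝔼 ε : Fin n → ℤˣ, 𝔼 x : K → ℤˣ,
          ⨆ t, (F t + ∑ i : Fin n, ((ε i : ℤ) : ℝ) * a i.succ t)
            + ∑ k, ((x k : ℤ) : ℝ) * b 0 k t :=
          Finset.expect_le_expect fun ε _ => iSup_add_iSup_le_expect _ _ _ (hab 0)
      _ = 𝔼 x : K → ℤˣ, 𝔼 ε : Fin n → ℤˣ,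
          ⨆ t, (F t + ∑ k, ((x k : ℤ) : ℝ) * b 0 k t)
            + ∑ i : Fin n, ((ε i : ℤ) : ℝ) * a i.succ t := by
          rw [Finset.expect_comm]
          refine Finset.expect_congr rfl fun x _ => Finset.expect_congr rfl fun ε _ => ?_
          congr 1; ext t; ring
      _ ≤ _ := by
          refine Finset.expect_le_expect fun x _ => ?_
          refine (ih _ (fun i => a i.succ) (fun i => b i.succ) fun i => hab i.succ).trans_eq ?_
          refine Finset.expect_congr rfl fun η _ => ?_
          congr 1; ext t; ring

end Contraction

/-! ### McDiarmid's inequality -/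

section BoundedDifferences

variable {Z : Type*} [MeasurableSpace Z] (D : Measure Z) [IsProbabilityMeasure D]

theorem integral_pi_fin_succ {n : ℕ} {f : (Fin (n + 1) → Z) → ℝ} (hf : Measurable f) {B : ℝ}
    (hB : ∀ S, |f S| ≤ B) :
    ∫ S, f S ∂(Measure.pi fun _ : Fin (n + 1) => D)
      = ∫ S, ∫ z, f (Fin.cons z S) ∂D ∂(Measure.pi fun _ : Fin n => D) := by
  have h := (measurePreserving_piFinSuccAbove (fun _ : Fin (n + 1) => D) 0).symm
  rw [← h.integral_comp', integral_prod_symm]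
  · simp [MeasurableEquiv.piFinSuccAbove, Fin.consEquiv]
  · refine Integrable.of_bound (hf.comp (MeasurableEquiv.measurable _)).aestronglyMeasurable B ?_
    exact Filter.Eventually.of_forall fun x => hB _

theorem measurable_fin_cons {n : ℕ} :
    Measurable fun q : (Fin n → Z) × Z => (Fin.cons q.2 q.1 : Fin (n + 1) → Z) := by
  refine measurable_pi_iff.2 fun i => ?_
  refine Fin.cases ?_ (fun j => ?_) i
  · simpa using measurable_snd
  · simpa [Function.comp_def] using (measurable_pi_apply j).comp measurable_fst

/-- McDiarmid's exponential moment bound for functions with bounded differences. -/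
theorem integral_exp_bounded_differences {c : ℝ} (s : ℝ) :
    ∀ (n : ℕ) (f : (Fin n → Z) → ℝ), Measurable f → ∀ B : ℝ, (∀ S, |f S| ≤ B) →
      (∀ S i z, |f (Function.update S i z) - f S| ≤ c) →
      ∫ S, Real.exp (s * (f S - ∫ S', f S' ∂(Measure.pi fun _ : Fin n => D)))
          ∂(Measure.pi fun _ : Fin n => D) ≤ Real.exp (n * c ^ 2 * s ^ 2 / 2) := by
  intro n
  induction n with
  | zero =>
    intro f _ B _ _
    have h (S : Fin 0 → Z) : f S = f finZeroElim := by congr 1; exact Subsingleton.elim _ _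
    simp [h]
  | succ n ih =>
    intro f hf B hB hd
    set μ := Measure.pi fun _ : Fin n => D with hμ
    have hcons (S : Fin n → Z) : Measurable fun z => f (Fin.cons z S) :=
      hf.comp (measurable_fin_cons.comp (measurable_const.prodMk measurable_id))
    have hint (S : Fin n → Z) : Integrable (fun z => f (Fin.cons z S)) D :=
      Integrable.of_bound (hcons S).aestronglyMeasurable B (.of_forall fun z => hB _)
    -- Averaging out the first coordinate preserves both the bound and the bounded differences, so
    -- the induction hypothesis applies to F, while Hoeffding's lemma controls the fluctuation of f
    -- around F.
    set F : (Fin n → Z) → ℝ := fun S => ∫ z, f (Fin.cons z S) ∂D with hF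
    have hFm : Measurable F :=
      ((hf.comp measurable_fin_cons).stronglyMeasurable.integral_prod_right' (ν := D)).measurable
    have hFB (S : Fin n → Z) : |F S| ≤ B := by
      have := norm_integral_le_of_norm_le_const (μ := D) (f := fun z => f (Fin.cons z S)) (C := B)
        (.of_forall fun z => hB _)
      simpa using this
    have hFd (S : Fin n → Z) (i : Fin n) (z : Z) : |F (Function.update S i z) - F S| ≤ c := by
      rw [hF]
      simp only
      rw [← integral_sub (hint _) (hint _)]
      have := norm_integral_le_of_norm_le_const (μ := D)
        (f := fun x => f (Fin.cons x (Function.update S i z)) - f (Fin.cons x S)) (C := c)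
        (.of_forall fun x => by
          rw [Fin.cons_update]
          exact hd _ _ _)
      simpa using this
    have hE : ∫ S, f S ∂(Measure.pi fun _ : Fin (n + 1) => D) = ∫ S, F S ∂μ :=
      integral_pi_fin_succ D hf hB
    set e := ∫ S, F S ∂μ with he
    have heB : |e| ≤ B := by
      have := norm_integral_le_of_norm_le_const (μ := μ) (f := F) (C := B)
        (.of_forall fun z => hFB _)
      simpa using this
    have hexpb (g : ℝ) (hg : |g| ≤ B) : |Real.exp (s * (g - e))| ≤ Real.exp (|s| * (2 * B)) := by
      rw [abs_of_pos (Real.exp_pos _), Real.exp_le_exp]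
      calc s * (g - e) ≤ |s * (g - e)| := le_abs_self _
        _ = |s| * |g - e| := abs_mul _ _
        _ ≤ |s| * (2 * B) := by
          have := abs_sub g e
          gcongr
          linarith
    have hfib (S : Fin n → Z) :
        ∫ z, Real.exp (s * (f (Fin.cons z S) - F S)) ∂D ≤ Real.exp (c ^ 2 * s ^ 2 / 2) := by
      -- The centred fibre lies in [-c, c], of length 2c, which gives variance proxy c². Using that
      -- its oscillation is at most c would give c²/4.
      have hsub : ProbabilityTheory.HasSubgaussianMGF (fun z => f (Fin.cons z S) - F S)
          ((‖c - -c‖₊ / 2) ^ 2) D := by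
        refine ProbabilityTheory.hasSubgaussianMGF_of_mem_Icc_of_integral_eq_zero
          ((hcons S).sub_const _).aemeasurable (.of_forall fun z => ?_) ?_
        · rw [Set.mem_Icc, ← abs_le, hF]
          simp only
          have h1 : f (Fin.cons z S) - ∫ x, f (Fin.cons x S) ∂D
              = ∫ x, (f (Fin.cons z S) - f (Fin.cons x S)) ∂D := by
            rw [integral_sub (integrable_const _) (hint S)]; simp
          rw [h1]
          have := norm_integral_le_of_norm_le_const (μ := D)
            (f := fun x => f (Fin.cons z S) - f (Fin.cons x S)) (C := c)
            (.of_forall fun x => by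
              have := hd (Fin.cons x S) 0 z
              rwa [Fin.update_cons_zero] at this)
          simpa using this
        · rw [integral_sub (hint S) (integrable_const _)]
          simp [hF]
      have := hsub.mgf_le s
      rw [ProbabilityTheory.mgf] at this
      convert this using 3
      simp only [NNReal.coe_pow, NNReal.coe_div, coe_nnnorm, Real.norm_eq_abs, NNReal.coe_ofNat]
      rw [div_pow, sq_abs]
      ring
    rw [hE, integral_pi_fin_succ D (B := Real.exp (|s| * (2 * B))) (by fun_prop)
      fun S => hexpb _ (hB S)]
    calc ∫ S, ∫ z, Real.exp (s * (f (Fin.cons z S) - e)) ∂D ∂μ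
        ≤ ∫ S, Real.exp (s * (F S - e)) * Real.exp (c ^ 2 * s ^ 2 / 2) ∂μ := by
          refine integral_mono_of_nonneg
            (.of_forall fun S => integral_nonneg fun z => (Real.exp_pos _).le) ?_
            (.of_forall fun S => ?_)
          · refine (Integrable.of_bound (C := Real.exp (|s| * (2 * B))) ?_
              (.of_forall fun S => hexpb _ (hFB S))).mul_const _
            exact (by fun_prop : Measurable fun S => Real.exp (s * (F S - e))).aestronglyMeasurable
          · simp only
            have h2 (z : Z) : Real.exp (s * (f (Fin.cons z S) - e))
                = Real.exp (s * (F S - e)) * Real.exp (s * (f (Fin.cons z S) - F S)) := by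
              rw [← Real.exp_add]; ring_nf
            simp_rw [h2]
            rw [integral_const_mul]
            exact mul_le_mul_of_nonneg_left (hfib S) (Real.exp_pos _).le
      _ = (∫ S, Real.exp (s * (F S - e)) ∂μ) * Real.exp (c ^ 2 * s ^ 2 / 2) := integral_mul_const _ _
      _ ≤ Real.exp (n * c ^ 2 * s ^ 2 / 2) * Real.exp (c ^ 2 * s ^ 2 / 2) :=
          mul_le_mul_of_nonneg_right (ih F hFm B hFB hFd) (Real.exp_pos _).le
      _ = _ := by rw [← Real.exp_add]; push_cast; ring_nf

/-- McDiarmid's inequality (with a suboptimal constant). -/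
theorem measureReal_bounded_differences {n : ℕ} {f : (Fin n → Z) → ℝ} (hf : Measurable f) {B c : ℝ}
    (hc : 0 ≤ c) (hB : ∀ S, |f S| ≤ B) (hd : ∀ S i z, |f (Function.update S i z) - f S| ≤ c)
    {ε : ℝ} (hε : 0 ≤ ε) :
    (Measure.pi fun _ : Fin n => D).real
        {S | ε ≤ f S - ∫ S', f S' ∂(Measure.pi fun _ : Fin n => D)}
      ≤ Real.exp (-ε ^ 2 / (2 * (n * c ^ 2))) := by
  have hsub : ProbabilityTheory.HasSubgaussianMGF
      (fun S => f S - ∫ S', f S' ∂(Measure.pi fun _ : Fin n => D)) (n * c.toNNReal ^ 2)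
      (Measure.pi fun _ : Fin n => D) := by
    refine ⟨fun s => ?_, fun s => ?_⟩
    · refine ProbabilityTheory.integrable_exp_mul_of_mem_Icc (hf.sub_const _).aemeasurable
        (a := -B - ∫ S', f S' ∂(Measure.pi fun _ : Fin n => D))
        (b := B - ∫ S', f S' ∂(Measure.pi fun _ : Fin n => D)) (.of_forall fun S => ?_)
      have := abs_le.1 (hB S)
      constructor <;> linarith
    · have := integral_exp_bounded_differences D s n f hf B hB hd
      simpa [ProbabilityTheory.mgf, hc] using this
  have := hsub.measure_ge_le hε
  simpa [hc] using this

end BoundedDifferences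

/-! ### Symmetrization and uniform deviation for finite classes -/

section Symmetrization

theorem abs_iSup_le_of_abs_le {T : Type*} [Finite T] [Nonempty T] {f : T → ℝ} {B : ℝ}
    (h : ∀ t, |f t| ≤ B) : |⨆ t, f t| ≤ B := by
  obtain ⟨t, ht⟩ := exists_eq_ciSup_of_finite (f := f)
  rw [← ht]
  exact h t

theorem abs_iSup_sub_iSup_le {T : Type*} [Finite T] [Nonempty T] {f g : T → ℝ} {B : ℝ}
    (h : ∀ t, |f t - g t| ≤ B) : |(⨆ t, f t) - ⨆ t, g t| ≤ B := by
  obtain ⟨t, ht⟩ := exists_eq_ciSup_of_finite (f := f)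
  obtain ⟨t', ht'⟩ := exists_eq_ciSup_of_finite (f := g)
  have h1 := le_ciSup_finite f t'
  have h2 := le_ciSup_finite g t
  have h3 := abs_le.1 (h t)
  have h4 := abs_le.1 (h t')
  rw [abs_le]
  constructor <;> linarith

theorem integral_comp_of_measurePreserving {α γ : Type*} [MeasurableSpace α] [MeasurableSpace γ]
    {μ : Measure α} {ν : Measure γ} {φ : α → γ} (h : MeasurePreserving φ μ ν) {f : γ → ℝ}
    (hf : Measurable f) : ∫ x, f (φ x) ∂μ = ∫ y, f y ∂ν := by
  rw [← h.map_eq, integral_map h.measurable.aemeasurable hf.aestronglyMeasurable]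

theorem integrable_of_measurable_of_abs_le {α : Type*} [MeasurableSpace α] {μ : Measure α}
    [IsFiniteMeasure μ] {f : α → ℝ} (hf : Measurable f) {B : ℝ} (hB : ∀ x, |f x| ≤ B) :
    Integrable f μ :=
  Integrable.of_bound hf.aestronglyMeasurable B (.of_forall hB)

variable {Z T : Type*} [MeasurableSpace Z] (D : Measure Z) [IsProbabilityMeasure D]
  [Finite T] [Nonempty T] {n : ℕ} {g : T → Z → ℝ} {B : ℝ}

theorem abs_sum_fin_le {f : Fin n → ℝ} {B : ℝ} (h : ∀ i, |f i| ≤ B) : |∑ i, f i| ≤ n * B := by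
  calc |∑ i, f i| ≤ ∑ i, |f i| := Finset.abs_sum_le_sum_abs _ _
    _ ≤ ∑ _i : Fin n, B := Finset.sum_le_sum fun i _ => h i
    _ = n * B := by simp

/-- Symmetrization with a ghost sample. -/
theorem integral_iSup_sum_sub_le_ghost (hg : ∀ t, Measurable (g t)) (hB : ∀ t z, |g t z| ≤ B) :
    ∫ S, (⨆ t, ∑ i, ((∫ z, g t z ∂D) - g t (S i))) ∂(Measure.pi fun _ : Fin n => D)
      ≤ ∫ W, (⨆ t, ∑ i, (g t (W i).1 - g t (W i).2))
          ∂(Measure.pi fun _ : Fin n => D.prod D) := by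
  set μ := Measure.pi fun _ : Fin n => D with hμ
  have hdiff (t : T) (x y : Z) : |g t x - g t y| ≤ 2 * B := by
    have := abs_sub (g t x) (g t y)
    linarith [hB t x, hB t y]
  have hE (t : T) : |∫ z, g t z ∂D| ≤ B := by
    simpa using norm_integral_le_of_norm_le_const (μ := D) (f := g t) (.of_forall (hB t))
  have hdiffE (t : T) (y : Z) : |(∫ z, g t z ∂D) - g t y| ≤ 2 * B := by
    have := abs_sub (∫ z, g t z ∂D) (g t y)
    linarith [hE t, hB t y]
  have hgi (t : T) (i : Fin n) : Measurable fun S : Fin n → Z => g t (S i) :=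
    (hg t).comp (measurable_pi_apply i)
  have hΨm : Measurable fun q : (Fin n → Z) × (Fin n → Z) =>
      ⨆ t, ∑ i, (g t (q.1 i) - g t (q.2 i)) :=
    Measurable.iSup fun t => Finset.measurable_sum _ fun i _ =>
      ((hgi t i).comp measurable_fst).sub ((hgi t i).comp measurable_snd)
  have hΨB (q : (Fin n → Z) × (Fin n → Z)) :
      |⨆ t, ∑ i, (g t (q.1 i) - g t (q.2 i))| ≤ n * (2 * B) :=
    abs_iSup_le_of_abs_le fun t => abs_sum_fin_le fun i => hdiff _ _ _
  have hmp := measurePreserving_arrowProdEquivProdArrow Z Z (Fin n) (fun _ => D) (fun _ => D)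
  have h2 : ∫ W, (⨆ t, ∑ i, (g t (W i).1 - g t (W i).2)) ∂(Measure.pi fun _ : Fin n => D.prod D)
      = ∫ q, (⨆ t, ∑ i, (g t (q.1 i) - g t (q.2 i))) ∂(μ.prod μ) :=
    integral_comp_of_measurePreserving hmp hΨm
  rw [h2, integral_prod_symm _ (integrable_of_measurable_of_abs_le hΨm hΨB)]
  refine integral_mono ?_ ?_ fun S => ?_
  · refine integrable_of_measurable_of_abs_le (B := n * (2 * B)) ?_ fun S =>
      abs_iSup_le_of_abs_le fun t => abs_sum_fin_le fun i => hdiffE _ _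
    exact Measurable.iSup fun t => Finset.measurable_sum _ fun i _ => (hgi t i).const_sub _
  · exact (integrable_of_measurable_of_abs_le hΨm hΨB).integral_prod_right
  -- For a fixed sample S, the expectation of g is its mean over the ghost sample S', and a supremum
  -- of integrals is at most the integral of the supremum.
  · refine ciSup_le fun t => ?_
    have h3 (i : Fin n) : ∫ S' : Fin n → Z, (g t (S' i) - g t (S i)) ∂μ
        = (∫ z, g t z ∂D) - g t (S i) := by
      rw [integral_sub (integrable_of_measurable_of_abs_le (hgi t i) fun _ => hB _ _)
        (integrable_const _), integral_comp_of_measurePreserving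
        (measurePreserving_eval (fun _ : Fin n => D) i) (hg t)]
      simp
    simp_rw [← h3]
    rw [← integral_finsetSum _ fun i _ => integrable_of_measurable_of_abs_le
      ((hgi t i).sub_const _) fun _ => hdiff _ _ _]
    refine integral_mono ?_ ?_ fun S' => ?_
    · exact integrable_of_measurable_of_abs_le
        (Finset.measurable_sum _ fun i _ => (hgi t i).sub_const _)
        fun S' => abs_sum_fin_le fun i => hdiff _ _ _
    · exact integrable_of_measurable_of_abs_le
        (hΨm.comp (measurable_id.prodMk measurable_const)) fun S' => hΨB (S', S)
    · exact le_ciSup_finite (fun t => ∑ i, (g t (S' i) - g t (S i))) t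

/-- The expected uniform deviation is at most twice the expected Rademacher average. -/
theorem integral_iSup_sum_sub_le (hg : ∀ t, Measurable (g t)) (hB : ∀ t z, |g t z| ≤ B) :
    ∫ S, (⨆ t, ∑ i, ((∫ z, g t z ∂D) - g t (S i))) ∂(Measure.pi fun _ : Fin n => D)
      ≤ 2 * ∫ S, 𝔼 ε : Fin n → ℤˣ, (⨆ t, ∑ i, ((ε i : ℤ) : ℝ) * g t (S i))
          ∂(Measure.pi fun _ : Fin n => D) := by
  refine (integral_iSup_sum_sub_le_ghost D hg hB).trans ?_
  set μ := Measure.pi fun _ : Fin n => D with hμ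
  set ν := Measure.pi fun _ : Fin n => D.prod D with hν
  set R : (Fin n → ℤˣ) → ℝ := fun ε => ∫ S, (⨆ t, ∑ i, ((ε i : ℤ) : ℝ) * g t (S i)) ∂μ with hR
  have hεm (ε : Fin n → ℤˣ) :
      Measurable fun S : Fin n → Z => ⨆ t, ∑ i, ((ε i : ℤ) : ℝ) * g t (S i) :=
    Measurable.iSup fun t => Finset.measurable_sum _ fun i _ =>
      ((hg t).comp (measurable_pi_apply i)).const_mul _
  have hεB (ε : Fin n → ℤˣ) (S : Fin n → Z) :
      |⨆ t, ∑ i, ((ε i : ℤ) : ℝ) * g t (S i)| ≤ n * B :=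
    abs_iSup_le_of_abs_le fun t => abs_sum_fin_le fun i => by
      rw [abs_mul, abs_intUnits, one_mul]; exact hB _ _
  have hΦm : Measurable fun W : Fin n → Z × Z => ⨆ t, ∑ i, (g t (W i).1 - g t (W i).2) :=
    Measurable.iSup fun t => Finset.measurable_sum _ fun i _ =>
      (((hg t).comp measurable_fst).sub ((hg t).comp measurable_snd)).comp (measurable_pi_apply i)
  have hfst : MeasurePreserving (fun (W : Fin n → Z × Z) i => (W i).1) ν μ :=
    measurePreserving_pi _ _ fun _ => measurePreserving_fst
  have hsnd : MeasurePreserving (fun (W : Fin n → Z × Z) i => (W i).2) ν μ :=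
    measurePreserving_pi _ _ fun _ => measurePreserving_snd
  -- Exchanging the two points of a pair wherever ε i = -1 preserves the law and multiplies the i-th
  -- difference by ε i.
  have hswap (ε : Fin n → ℤˣ) : MeasurePreserving
      (fun (W : Fin n → Z × Z) i => if ε i = 1 then W i else (W i).swap) ν ν := by
    refine measurePreserving_pi (f := fun i (w : Z × Z) => if ε i = 1 then w else w.swap) _ _
      fun i => ?_
    by_cases h : ε i = 1
    · simpa [h] using! MeasurePreserving.id (D.prod D)
    · simpa [h] using (Measure.measurePreserving_swap (μ := D) (ν := D))
  have hkey (ε : Fin n → ℤˣ) :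
      ∫ W, (⨆ t, ∑ i, (g t (W i).1 - g t (W i).2)) ∂ν ≤ R ε + R (-ε) := by
    rw [← integral_comp_of_measurePreserving (hswap ε) hΦm]
    simp only [hR]
    rw [← integral_comp_of_measurePreserving hfst (hεm ε),
      ← integral_comp_of_measurePreserving hsnd (hεm (-ε)), ← integral_add]
    · refine integral_mono ?_ ?_ fun W => ?_
      · refine integrable_of_measurable_of_abs_le (B := n * (2 * B))
          (hΦm.comp (hswap ε).measurable) fun W => ?_
        refine abs_iSup_le_of_abs_le fun t => abs_sum_fin_le fun i => ?_
        refine (abs_sub _ _).trans ?_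
        linarith [hB t (if ε i = 1 then W i else (W i).swap).1,
          hB t (if ε i = 1 then W i else (W i).swap).2]
      · exact (integrable_of_measurable_of_abs_le ((hεm ε).comp hfst.measurable) fun W =>
          hεB _ _).add (integrable_of_measurable_of_abs_le ((hεm (-ε)).comp hsnd.measurable)
          fun W => hεB _ _)
      · refine ciSup_le fun t => ?_
        refine le_trans (le_of_eq ?_) (add_le_add
          (le_ciSup_finite (fun t => ∑ i, ((ε i : ℤ) : ℝ) * g t (W i).1) t)
          (le_ciSup_finite (fun t => ∑ i, (((-ε) i : ℤ) : ℝ) * g t (W i).2) t))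
        rw [← Finset.sum_add_distrib]
        refine Finset.sum_congr rfl fun i _ => ?_
        rcases Int.units_eq_one_or (ε i) with h | h <;> simp [h]
        all_goals ring
    · exact integrable_of_measurable_of_abs_le ((hεm ε).comp hfst.measurable) fun W => hεB _ _
    · exact integrable_of_measurable_of_abs_le ((hεm (-ε)).comp hsnd.measurable) fun W => hεB _ _
  -- The left side of `hkey` does not depend on ε; averaging, R ε and R (-ε) have the same mean,
  -- whence the factor 2.
  have havg := Finset.expect_le_expect (s := (Finset.univ : Finset (Fin n → ℤˣ)))
    fun ε _ => hkey ε
  rw [Fintype.expect_const, Finset.expect_add_distrib,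
    Fintype.expect_equiv (Equiv.neg _) (fun ε => R (-ε)) R fun _ => rfl] at havg
  refine havg.trans_eq ?_
  have : ∫ S, 𝔼 ε : Fin n → ℤˣ, (⨆ t, ∑ i, ((ε i : ℤ) : ℝ) * g t (S i)) ∂μ = 𝔼 ε, R ε := by
    simp_rw [Fintype.expect_eq_sum_div_card (K := ℝ)]
    rw [integral_div, integral_finsetSum _ fun ε _ =>
      integrable_of_measurable_of_abs_le (hεm ε) (hεB ε)]
  rw [this]
  ring

/-- Uniform deviation bound for a finite class `g` of bounded functions whose increments are
dominated by a finite family `b` of features with Rademacher average at most `Q`. -/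
theorem measureReal_exists_deviation_le {K : Type*} [Fintype K] [DecidableEq K]
    (hg : ∀ t, Measurable (g t)) (hB0 : 0 ≤ B) (hB : ∀ t z, |g t z| ≤ B) (b : K → T → Z → ℝ)
    (hab : ∀ z t t' m, (∀ k, |b k t z - b k t' z| ≤ m) → 0 ≤ m → |g t z - g t' z| ≤ m) {Q : ℝ}
    (hQ : ∀ S : Fin n → Z,
      𝔼 η : Fin n → K → ℤˣ, (⨆ t, ∑ i, ∑ k, ((η i k : ℤ) : ℝ) * b k t (S i)) ≤ Q)
    {ε : ℝ} (hε : 0 ≤ ε) :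
    (Measure.pi fun _ : Fin n => D).real
        {S | ∃ t, 2 * Q + ε < ∑ i, ((∫ z, g t z ∂D) - g t (S i))}
      ≤ Real.exp (-ε ^ 2 / (2 * (n * (2 * B) ^ 2))) := by
  have hdiff (t : T) (x y : Z) : |g t x - g t y| ≤ 2 * B := by
    have := abs_sub (g t x) (g t y)
    linarith [hB t x, hB t y]
  have hdiffE (t : T) (y : Z) : |(∫ z, g t z ∂D) - g t y| ≤ 2 * B := by
    have hE : |∫ z, g t z ∂D| ≤ B := by
      simpa using norm_integral_le_of_norm_le_const (μ := D) (f := g t) (.of_forall (hB t))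
    have := abs_sub (∫ z, g t z ∂D) (g t y)
    linarith [hB t y]
  have hE : ∫ S, (⨆ t, ∑ i, ((∫ z, g t z ∂D) - g t (S i))) ∂(Measure.pi fun _ : Fin n => D)
      ≤ 2 * Q := by
    refine (integral_iSup_sum_sub_le D hg hB).trans ?_
    refine mul_le_mul_of_nonneg_left ?_ zero_le_two
    have h1 (S : Fin n → Z) :
        𝔼 ε : Fin n → ℤˣ, (⨆ t, ∑ i, ((ε i : ℤ) : ℝ) * g t (S i)) ≤ Q := by
      have := expect_iSup_le_expect_iSup (T := T) n 0 (fun i t => g t (S i))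
        (fun i k t => b k t (S i)) fun i => hab (S i)
      simp only [Pi.zero_apply, zero_add] at this
      exact this.trans (hQ S)
    calc _ ≤ ∫ _S, Q ∂(Measure.pi fun _ : Fin n => D) := by
          refine integral_mono ?_ (integrable_const _) h1
          refine integrable_of_measurable_of_abs_le (B := n * B) ?_ fun S => ?_
          · simp_rw [Fintype.expect_eq_sum_div_card (K := ℝ)]
            refine (Finset.measurable_sum _ fun ε _ => ?_).div_const _
            exact Measurable.iSup fun t => Finset.measurable_sum _ fun i _ =>
              ((hg t).comp (measurable_pi_apply i)).const_mul _
          · refine (Finset.abs_expect_le _ _).trans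
              (Finset.expect_le Finset.univ_nonempty fun ε _ => ?_)
            exact abs_iSup_le_of_abs_le fun t => abs_sum_fin_le fun i => by
              rw [abs_mul, abs_intUnits, one_mul]; exact hB _ _
      _ = Q := by simp
  -- Replacing one sample point changes a single summand, by at most 2B, hence the supremum by at
  -- most 2B.
  have hmc := measureReal_bounded_differences D (n := n)
    (f := fun S => ⨆ t, ∑ i, ((∫ z, g t z ∂D) - g t (S i))) (B := n * (2 * B)) (c := 2 * B)
    (Measurable.iSup fun t => Finset.measurable_sum _ fun i _ =>
      ((hg t).comp (measurable_pi_apply i)).const_sub _) (by positivity)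
    (fun S => abs_iSup_le_of_abs_le fun t => abs_sum_fin_le fun i => hdiffE _ _)
    (fun S i z => abs_iSup_sub_iSup_le fun t => by
      rw [← Finset.sum_sub_distrib, Finset.sum_eq_single i]
      · simpa using hdiff t (S i) z
      · intro j _ hj
        simp [hj]
      · simp) hε
  refine (measureReal_mono ?_).trans hmc
  rintro S ⟨t, ht⟩
  have := le_ciSup_finite (fun t => ∑ i, ((∫ z, g t z ∂D) - g t (S i))) t
  simp only [Set.mem_ofPred_eq]
  linarith

end Symmetrization

/-! ### Lipschitz estimates for softmax -/

section Softmax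

variable {A : Type*} [Fintype A]

/-- The softmax weights with inverse temperature `β`. -/
noncomputable def softmax (β : ℝ) (v : A → ℝ) (a : A) : ℝ :=
  Real.exp (-β * v a) / ∑ a', Real.exp (-β * v a')

theorem softmax_nonneg (β : ℝ) (v : A → ℝ) (a : A) : 0 ≤ softmax β v a :=
  div_nonneg (Real.exp_pos _).le (Finset.sum_nonneg fun _ _ => (Real.exp_pos _).le)

/-- Only an inequality, because the sum is 0 when A is empty. -/
theorem sum_softmax_le_one (β : ℝ) (v : A → ℝ) : ∑ a, softmax β v a ≤ 1 := by
  simp_rw [softmax]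
  rw [← Finset.sum_div]
  exact div_self_le_one _

/-- A perturbation of size m costs a factor exp(-βm) in the numerator and another in the normalizing
sum. This multiplicative form yields an ℓ¹ bound free of |A|. -/
theorem exp_mul_softmax_le {β m : ℝ} (hβ : 0 ≤ β) {v v' : A → ℝ} (h : ∀ a, |v a - v' a| ≤ m)
    (a : A) : Real.exp (-(2 * β * m)) * softmax β v a ≤ softmax β v' a := by
  have hpos (v : A → ℝ) : 0 < ∑ a', Real.exp (-β * v a') :=
    Finset.sum_pos (fun _ _ => Real.exp_pos _) ⟨a, Finset.mem_univ a⟩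
  have hnum : Real.exp (-(β * m)) * Real.exp (-β * v a) ≤ Real.exp (-β * v' a) := by
    rw [← Real.exp_add, Real.exp_le_exp]
    have := mul_le_mul_of_nonneg_left (abs_le.1 (h a)).1 hβ
    linarith
  have hden : Real.exp (-(β * m)) * ∑ a', Real.exp (-β * v' a') ≤ ∑ a', Real.exp (-β * v a') := by
    rw [Finset.mul_sum]
    refine Finset.sum_le_sum fun a' _ => ?_
    rw [← Real.exp_add, Real.exp_le_exp]
    have := mul_le_mul_of_nonneg_left (abs_le.1 (h a')).2 hβ
    linarith
  rw [softmax, softmax, ← mul_div_assoc, div_le_div_iff₀ (hpos v) (hpos v')]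
  have he : Real.exp (-(2 * β * m)) = Real.exp (-(β * m)) * Real.exp (-(β * m)) := by
    rw [← Real.exp_add]; ring_nf
  calc Real.exp (-(2 * β * m)) * Real.exp (-β * v a) * ∑ a', Real.exp (-β * v' a')
      = (Real.exp (-(β * m)) * Real.exp (-β * v a))
          * (Real.exp (-(β * m)) * ∑ a', Real.exp (-β * v' a')) := by rw [he]; ring
    _ ≤ _ := mul_le_mul hnum hden (mul_nonneg (Real.exp_pos _).le (hpos _).le) (Real.exp_pos _).le

/-- Softmax is `4β`-Lipschitz from the sup norm to the `ℓ¹` norm. -/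
theorem sum_abs_softmax_sub_le {β m : ℝ} (hβ : 0 ≤ β) (hm : 0 ≤ m) {v v' : A → ℝ}
    (h : ∀ a, |v a - v' a| ≤ m) : ∑ a, |softmax β v a - softmax β v' a| ≤ 4 * β * m := by
  have hexp : 1 - 2 * β * m ≤ Real.exp (-(2 * β * m)) := by
    linarith [Real.add_one_le_exp (-(2 * β * m))]
  have h0 : 0 ≤ 2 * β * m := by positivity
  have hpt (a : A) : |softmax β v a - softmax β v' a|
      ≤ 2 * β * m * softmax β v a + 2 * β * m * softmax β v' a := by
    have h1 := exp_mul_softmax_le hβ h a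
    have h2 := exp_mul_softmax_le hβ (fun a => by rw [abs_sub_comm]; exact h a) a (v := v') (v' := v)
    have s1 := softmax_nonneg β v a
    have s2 := softmax_nonneg β v' a
    have h3 := mul_le_mul_of_nonneg_right hexp s1
    have h4 := mul_le_mul_of_nonneg_right hexp s2
    have h5 := mul_nonneg h0 s1
    have h6 := mul_nonneg h0 s2
    rw [abs_le]
    constructor <;> linarith
  calc ∑ a, |softmax β v a - softmax β v' a|
      ≤ ∑ a, (2 * β * m * softmax β v a + 2 * β * m * softmax β v' a) :=
        Finset.sum_le_sum fun a _ => hpt a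
    _ = 2 * β * m * ∑ a, softmax β v a + 2 * β * m * ∑ a, softmax β v' a := by
        rw [Finset.sum_add_distrib, Finset.mul_sum, Finset.mul_sum]
    _ ≤ 2 * β * m * 1 + 2 * β * m * 1 :=
        add_le_add (mul_le_mul_of_nonneg_left (sum_softmax_le_one _ _) h0)
          (mul_le_mul_of_nonneg_left (sum_softmax_le_one _ _) h0)
    _ = 4 * β * m := by ring

theorem abs_sum_mul_softmax_le {β m : ℝ} {u v : A → ℝ} (hm : 0 ≤ m) (hu : ∀ a, |u a| ≤ m) :
    |∑ a, u a * softmax β v a| ≤ m := by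
  calc |∑ a, u a * softmax β v a| ≤ ∑ a, |u a * softmax β v a| := Finset.abs_sum_le_sum_abs _ _
    _ ≤ ∑ a, m * softmax β v a := Finset.sum_le_sum fun a _ => by
        rw [abs_mul, abs_of_nonneg (softmax_nonneg _ _ _)]
        exact mul_le_mul_of_nonneg_right (hu a) (softmax_nonneg _ _ _)
    _ = m * ∑ a, softmax β v a := by rw [Finset.mul_sum]
    _ ≤ m * 1 := mul_le_mul_of_nonneg_left (sum_softmax_le_one _ _) hm
    _ = m := mul_one m

/-- Softmax averages are Lipschitz for the sup norm, jointly in the values and the weights. -/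
theorem abs_sum_mul_softmax_sub_le {β m U : ℝ} (hβ : 0 ≤ β) (hm : 0 ≤ m) (hU : 0 ≤ U)
    {u u' v v' : A → ℝ} (hu' : ∀ a, |u' a| ≤ U) (hu : ∀ a, |u a - u' a| ≤ m)
    (hv : ∀ a, |v a - v' a| ≤ m) :
    |∑ a, u a * softmax β v a - ∑ a, u' a * softmax β v' a| ≤ (1 + 4 * β * U) * m := by
  have hsplit : ∑ a, u a * softmax β v a - ∑ a, u' a * softmax β v' a
      = ∑ a, (u a - u' a) * softmax β v a + ∑ a, u' a * (softmax β v a - softmax β v' a) := by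
    rw [← Finset.sum_sub_distrib, ← Finset.sum_add_distrib]
    exact Finset.sum_congr rfl fun a _ => by ring
  have h2 : |∑ a, u' a * (softmax β v a - softmax β v' a)| ≤ U * (4 * β * m) := by
    calc _ ≤ ∑ a, |u' a * (softmax β v a - softmax β v' a)| := Finset.abs_sum_le_sum_abs _ _
      _ ≤ ∑ a, U * |softmax β v a - softmax β v' a| := Finset.sum_le_sum fun a _ => by
          rw [abs_mul]
          exact mul_le_mul_of_nonneg_right (hu' a) (abs_nonneg _)
      _ = U * ∑ a, |softmax β v a - softmax β v' a| := by rw [Finset.mul_sum]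
      _ ≤ _ := mul_le_mul_of_nonneg_left (sum_abs_softmax_sub_le hβ hm hv) hU
  rw [hsplit]
  refine (abs_add_le _ _).trans ?_
  have h1 := abs_sum_mul_softmax_le (β := β) (v := v) hm hu
  linarith

end Softmax

/-! ### Uniform deviation of the gap functions -/

section Gap

theorem abs_inner_le_mul {H : Type*} [NormedAddCommGroup H] [InnerProductSpace ℝ H] {x y : H}
    {r s : ℝ} (hx : ‖x‖ ≤ r) (hy : ‖y‖ ≤ s) : |⟪x, y⟫_ℝ| ≤ r * s :=
  (abs_real_inner_le_norm x y).trans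
    (mul_le_mul hx hy (norm_nonneg _) ((norm_nonneg _).trans hx))

theorem zero_mem_lossClass {A H : Type*} [NormedAddCommGroup H] {R₁ : ℝ} (hR₁ : 0 ≤ R₁) :
    (0 : A → H) ∈ lossClass A H R₁ := fun a => by
  simpa using hR₁

variable {X Y A H : Type*} [Fintype A] [NormedAddCommGroup H] [InnerProductSpace ℝ H]
  [CompleteSpace H] [RKHS ℝ H Y ℝ] {β R₁ R₂ : ℝ} {p : X → H}

theorem gap_eq (β : ℝ) (p : X → H) (ℓ ℓ' : A → H) (z : X × Y) :
    gap β p ℓ ℓ' z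
      = ∑ a, ⟪ℓ a, featureMap H z.2 - p z.1⟫_ℝ * softmax β (fun a => ⟪ℓ' a, p z.1⟫_ℝ) a := rfl

/-- With the symmetry of the loss class, this turns one-sided uniform bounds into two-sided ones. -/
theorem gap_neg (ℓ ℓ' : A → H) (z : X × Y) : gap β p (-ℓ) ℓ' z = -gap β p ℓ ℓ' z := by
  simp [gap_eq, inner_neg_left]

theorem norm_featureMap_sub_le (hφ : ∀ y : Y, ‖featureMap H y‖ ≤ R₂) (hp : ∀ x, ‖p x‖ ≤ R₂)
    (z : X × Y) : ‖featureMap H z.2 - p z.1‖ ≤ 2 * R₂ := by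
  have := norm_sub_le (featureMap H z.2) (p z.1)
  linarith [hφ z.2, hp z.1]

theorem abs_gap_le (hR₁ : 0 ≤ R₁) (hR₂ : 0 ≤ R₂) (hφ : ∀ y : Y, ‖featureMap H y‖ ≤ R₂)
    (hp : ∀ x, ‖p x‖ ≤ R₂) {ℓ : A → H} (hℓ : ℓ ∈ lossClass A H R₁) (ℓ' : A → H) (z : X × Y) :
    |gap β p ℓ ℓ' z| ≤ 2 * (R₁ * R₂) := by
  rw [gap_eq]
  refine abs_sum_mul_softmax_le (by positivity) fun a => ?_
  exact (abs_inner_le_mul (hℓ a) (norm_featureMap_sub_le hφ hp z)).trans_eq (by ring)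

theorem continuous_gap (β : ℝ) (p : X → H) (z : X × Y) :
    Continuous fun q : (A → H) × (A → H) => gap β p q.1 q.2 z := by
  rcases isEmpty_or_nonempty A with hA | hA
  · simpa [gap_eq] using continuous_const
  · simp only [gap_eq, softmax]
    refine continuous_finsetSum _ fun a _ => Continuous.mul (by fun_prop) ?_
    refine Continuous.div (by fun_prop) (by fun_prop) fun q => ?_
    exact (Finset.sum_pos (fun _ _ => Real.exp_pos _) Finset.univ_nonempty).ne'

/-- The Rademacher average of the linear features that control the gap functions. -/
theorem expect_iSup_features_le {T : Type*} [Finite T] [Nonempty T] [DecidableEq A]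
    (hR₁ : 0 ≤ R₁) (hR₂ : 0 ≤ R₂) (hφ : ∀ y : Y, ‖featureMap H y‖ ≤ R₂) (hp : ∀ x, ‖p x‖ ≤ R₂)
    {ℓ ℓ' : T → A → H} (hℓ : ∀ t, ℓ t ∈ lossClass A H R₁) (hℓ' : ∀ t, ℓ' t ∈ lossClass A H R₁)
    {n : ℕ} (S : Fin n → X × Y) {L : ℝ} (hL : 0 ≤ L) :
    𝔼 η : Fin n → A ⊕ A → ℤˣ, (⨆ t, ∑ i, ∑ k, ((η i k : ℤ) : ℝ) * Sum.elim
        (fun a => L * ⟪ℓ t a, featureMap H (S i).2 - p (S i).1⟫_ℝ)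
        (fun a => L * ⟪ℓ' t a, p (S i).1⟫_ℝ) k)
      ≤ 3 * L * Fintype.card A * (R₁ * R₂) * √n := by
  have hpt (η : Fin n → A ⊕ A → ℤˣ) : (⨆ t, ∑ i, ∑ k, ((η i k : ℤ) : ℝ) * Sum.elim
        (fun a => L * ⟪ℓ t a, featureMap H (S i).2 - p (S i).1⟫_ℝ)
        (fun a => L * ⟪ℓ' t a, p (S i).1⟫_ℝ) k)
      ≤ ∑ a, L * R₁ * (‖∑ i, ((η i (.inl a) : ℤ) : ℝ) • (featureMap H (S i).2 - p (S i).1)‖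
          + ‖∑ i, ((η i (.inr a) : ℤ) : ℝ) • p (S i).1‖) := by
    refine ciSup_le fun t => ?_
    rw [Finset.sum_comm]
    simp only [Fintype.sum_sum_type, Sum.elim_inl, Sum.elim_inr]
    rw [← Finset.sum_add_distrib]
    refine Finset.sum_le_sum fun a _ => ?_
    -- Cauchy–Schwarz removes the loss: what remains depends on the signs and the sample only.
    have key (h : H) (hh : ‖h‖ ≤ R₁) (s : Fin n → ℝ) (w : Fin n → H) :
        ∑ i, s i * (L * ⟪h, w i⟫_ℝ) ≤ L * R₁ * ‖∑ i, s i • w i‖ := by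
      have e : ∑ i, s i * (L * ⟪h, w i⟫_ℝ) = L * ⟪h, ∑ i, s i • w i⟫_ℝ := by
        rw [inner_sum, Finset.mul_sum]
        exact Finset.sum_congr rfl fun i _ => by rw [real_inner_smul_right]; ring
      rw [e, mul_assoc]
      refine mul_le_mul_of_nonneg_left ?_ hL
      exact (real_inner_le_norm _ _).trans (mul_le_mul_of_nonneg_right hh (norm_nonneg _))
    rw [mul_add]
    exact add_le_add (key _ (hℓ t a) _ _) (key _ (hℓ' t a) _ _)
  calc _ ≤ 𝔼 η : Fin n → A ⊕ A → ℤˣ, ∑ a, L * R₁ *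
          (‖∑ i, ((η i (.inl a) : ℤ) : ℝ) • (featureMap H (S i).2 - p (S i).1)‖
          + ‖∑ i, ((η i (.inr a) : ℤ) : ℝ) • p (S i).1‖) :=
        Finset.expect_le_expect fun η _ => hpt η
    _ ≤ ∑ _a : A, L * R₁ * (√n * (2 * R₂) + √n * R₂) := by
        rw [Finset.expect_sum_comm]
        refine Finset.sum_le_sum fun a _ => ?_
        rw [← Finset.mul_expect, Finset.expect_add_distrib]
        refine mul_le_mul_of_nonneg_left (add_le_add ?_ ?_) (by positivity)
        · exact expect_norm_sum_le _ (by positivity)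
            (fun i => norm_featureMap_sub_le hφ hp (S i)) _
        · exact expect_norm_sum_le _ hR₂ (fun i => hp _) _
    _ = _ := by
        rw [Finset.sum_const, Finset.card_univ, nsmul_eq_mul]
        ring

variable [MeasurableSpace X] [MeasurableSpace Y] [TopologicalSpace.SeparableSpace H]
  [MeasurableSpace H] [BorelSpace H]

theorem measurable_gap (hφ : Measurable (featureMap H : Y → H)) (hp : Measurable p)
    (ℓ ℓ' : A → H) : Measurable fun z : X × Y => gap β p ℓ ℓ' z := by
  have : SecondCountableTopology H := UniformSpace.secondCountable_of_separable H
  simp only [gap_eq, softmax]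
  have h1 : Measurable fun z : X × Y => featureMap H z.2 := hφ.comp measurable_snd
  have h2 : Measurable fun z : X × Y => p z.1 := hp.comp measurable_fst
  have h3 (h : H) : Measurable fun z : X × Y => ⟪h, p z.1⟫_ℝ := measurable_const.inner h2
  have h4 (h : H) : Measurable fun z : X × Y => ⟪h, featureMap H z.2 - p z.1⟫_ℝ :=
    measurable_const.inner (h1.sub h2)
  refine Finset.measurable_sum _ fun a _ => (h4 _).mul ?_
  exact ((h3 _).const_mul _).exp.div (Finset.measurable_sum _ fun a' _ => ((h3 _).const_mul _).exp)

variable (D : Measure (X × Y)) [IsProbabilityMeasure D]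

/-- The uniform deviation bound for finite classes, applied to the 2|A| linear features. These are
scaled by L so that they dominate the increments of the gap with constant 1. -/
theorem measureReal_exists_gap_deviation_le {T : Type*} [Finite T] [Nonempty T] (hβ : 0 ≤ β)
    (hR₁ : 0 ≤ R₁) (hR₂ : 0 ≤ R₂) (hφm : Measurable (featureMap H : Y → H))
    (hφ : ∀ y : Y, ‖featureMap H y‖ ≤ R₂) (hpm : Measurable p) (hp : ∀ x, ‖p x‖ ≤ R₂)
    {ℓ ℓ' : T → A → H} (hℓ : ∀ t, ℓ t ∈ lossClass A H R₁) (hℓ' : ∀ t, ℓ' t ∈ lossClass A H R₁)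
    {n : ℕ} {ε : ℝ} (hε : 0 ≤ ε) :
    (Measure.pi fun _ : Fin n => D).real
        {S | ∃ t, 2 * (3 * (1 + 8 * (β * (R₁ * R₂))) * Fintype.card A * (R₁ * R₂) * √n) + ε
          < ∑ i, ((∫ z, gap β p (ℓ t) (ℓ' t) z ∂D) - gap β p (ℓ t) (ℓ' t) (S i))}
      ≤ Real.exp (-ε ^ 2 / (2 * (n * (4 * (R₁ * R₂)) ^ 2))) := by
  classical
  set L : ℝ := 1 + 8 * (β * (R₁ * R₂)) with hLdef
  have hL : 0 < L := by positivity
  have h := measureReal_exists_deviation_le D (n := n) (g := fun t z => gap β p (ℓ t) (ℓ' t) z)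
    (B := 2 * (R₁ * R₂)) (fun t => measurable_gap hφm hpm _ _) (by positivity)
    (fun t z => abs_gap_le hR₁ hR₂ hφ hp (hℓ t) _ z)
    (fun (k : A ⊕ A) t z => Sum.elim (fun a => L * ⟪ℓ t a, featureMap H z.2 - p z.1⟫_ℝ)
        (fun a => L * ⟪ℓ' t a, p z.1⟫_ℝ) k)
    (fun z t t' m hk hm => by
      have hdiv {x y : ℝ} (hxy : |L * x - L * y| ≤ m) : |x - y| ≤ m / L := by
        rw [← mul_sub, abs_mul, abs_of_pos hL] at hxy
        rwa [le_div_iff₀' hL]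
      rw [gap_eq, gap_eq]
      refine (abs_sum_mul_softmax_sub_le hβ (div_nonneg hm hL.le)
        (U := 2 * (R₁ * R₂)) (by positivity)
        (fun a => (abs_inner_le_mul (hℓ t' a) (norm_featureMap_sub_le hφ hp z)).trans_eq
          (by ring))
        (fun a => hdiv (hk (.inl a))) (fun a => hdiv (hk (.inr a)))).trans_eq ?_
      rw [show 1 + 4 * β * (2 * (R₁ * R₂)) = L by rw [hLdef]; ring]
      field_simp)
    (fun S => expect_iSup_features_le hR₁ hR₂ hφ hp hℓ hℓ' S hL.le) hε
  refine h.trans_eq ?_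
  ring_nf

/-- Uniform one-sided deviation bound over the whole loss class. -/
theorem measure_exists_lossClass_deviation_le (hβ : 0 ≤ β)
    (hR₁ : 0 ≤ R₁) (hR₂ : 0 ≤ R₂) (hφm : Measurable (featureMap H : Y → H))
    (hφ : ∀ y : Y, ‖featureMap H y‖ ≤ R₂) (hpm : Measurable p) (hp : ∀ x, ‖p x‖ ≤ R₂)
    {n : ℕ} {ε : ℝ} (hε : 0 ≤ ε) :
    (Measure.pi fun _ : Fin n => D)
        {S | ∃ ℓ ∈ lossClass A H R₁, ∃ ℓ' ∈ lossClass A H R₁,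
          2 * (3 * (1 + 8 * (β * (R₁ * R₂))) * Fintype.card A * (R₁ * R₂) * √n) + ε
          < ∑ i, ((∫ z, gap β p ℓ ℓ' z ∂D) - gap β p ℓ ℓ' (S i))}
      ≤ ENNReal.ofReal (Real.exp (-ε ^ 2 / (2 * (n * (4 * (R₁ * R₂)) ^ 2)))) := by
  set r : ℝ := 2 * (3 * (1 + 8 * (β * (R₁ * R₂))) * Fintype.card A * (R₁ * R₂) * √n) + ε
  have : SecondCountableTopology H := UniformSpace.secondCountable_of_separable H
  let P := {q : (A → H) × (A → H) // q.1 ∈ lossClass A H R₁ ∧ q.2 ∈ lossClass A H R₁}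
  have : Nonempty P := ⟨⟨0, zero_mem_lossClass hR₁, zero_mem_lossClass hR₁⟩⟩
  -- A strict deviation is an open condition on the pair of losses, so if it occurs at all it occurs
  -- along a dense sequence. The event is thus covered by an increasing union of events for finite
  -- families, whose bound does not depend on the family.
  let d : ℕ → P := TopologicalSpace.denseSeq P
  let Δ : P → (Fin n → X × Y) → ℝ := fun q S =>
    ∑ i, ((∫ z, gap β p q.1.1 q.1.2 z ∂D) - gap β p q.1.1 q.1.2 (S i))
  have hΔ (S : Fin n → X × Y) : Continuous fun q => Δ q S := by
    refine continuous_finsetSum _ fun i _ => Continuous.sub ?_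
      ((continuous_gap β p (S i)).comp continuous_subtype_val)
    -- The expected gap is continuous in the losses by dominated convergence, the gap being bounded
    -- by 2R₁R₂ on the class.
    refine continuous_of_dominated (bound := fun _ => 2 * (R₁ * R₂))
      (fun q => (measurable_gap hφm hpm _ _).aestronglyMeasurable)
      (fun q => .of_forall fun z => abs_gap_le hR₁ hR₂ hφ hp q.2.1 _ z) (integrable_const _)
      (.of_forall fun z => (continuous_gap β p z).comp continuous_subtype_val)
  have hsub : {S | ∃ ℓ ∈ lossClass A H R₁, ∃ ℓ' ∈ lossClass A H R₁,
          r < ∑ i, ((∫ z, gap β p ℓ ℓ' z ∂D) - gap β p ℓ ℓ' (S i))}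
      ⊆ ⋃ m : ℕ, {S | ∃ t : Fin (m + 1), r < Δ (d t) S} := by
    rintro S ⟨ℓ, hℓ, ℓ', hℓ', hS⟩
    obtain ⟨j, hj⟩ := (TopologicalSpace.denseRange_denseSeq P).exists_mem_open
      (isOpen_lt continuous_const (hΔ S)) ⟨⟨(ℓ, ℓ'), hℓ, hℓ'⟩, hS⟩
    exact Set.mem_iUnion.2 ⟨j, ⟨j, Nat.lt_succ_self j⟩, hj⟩
  have hmono : Monotone fun m : ℕ => {S | ∃ t : Fin (m + 1), r < Δ (d t) S} := by
    rintro m m' hm S ⟨t, ht⟩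
    exact ⟨⟨t, by omega⟩, ht⟩
  refine (measure_mono hsub).trans ?_
  rw [hmono.measure_iUnion]
  refine iSup_le fun m => ?_
  have := measureReal_exists_gap_deviation_le D (T := Fin (m + 1)) (n := n) hβ hR₁ hR₂ hφm hφ hpm hp
    (fun t => (d t).2.1) (fun t => (d t).2.2) hε
  rw [measureReal_def] at this
  exact (ENNReal.le_ofReal_iff_toReal_le (measure_ne_top _ _) (Real.exp_pos _).le).2 this

end Gap

/-! ### Comparison of constants and the main theorem -/

/-- The constant in the uniform convergence bound. -/
noncomputable def gapConstant (c : ℝ) : ℝ :=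
  (6 * (1 / c ^ 2 + 8 / c) + 8 / c) / Real.log (1 + c) + 1

theorem gapConstant_pos {c : ℝ} (hc : 0 < c) : 0 < gapConstant c := by
  have := Real.log_pos (by linarith : 1 < 1 + c)
  unfold gapConstant
  positivity

/-- With b = βM ≥ c, both M and bM are at most a constant times b²M = β²M³, and β²M ≥ c does the
same for M². The factor log N ≥ log(1 + c) > 0 is inserted at the price of dividing by log(1 + c).
-/
theorem deviation_arithmetic {c M β N Λ a : ℝ} (hc : 0 < c) (hM : 0 < M) (hβ : 0 < β)
    (h1 : c ≤ β * M) (h2 : c ≤ β ^ 2 * M) (hN : 1 + c ≤ N) (hΛ : 0 ≤ Λ) (ha : 1 ≤ a) :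
    6 * (1 + 8 * (β * M)) * a * M + 4 * M * √(2 * Λ)
      ≤ gapConstant c * (a ^ (3 / 2 : ℝ) * β ^ 2 * M ^ 3 * Real.log N + Λ) := by
  have hlog : 0 < Real.log (1 + c) := Real.log_pos (by linarith)
  have hlogN : Real.log (1 + c) ≤ Real.log N := Real.log_le_log (by linarith) hN
  have haa : a ≤ a ^ (3 / 2 : ℝ) := by
    simpa using Real.rpow_le_rpow_of_exponent_le ha (by norm_num : (1 : ℝ) ≤ 3 / 2)
  set a' := a ^ (3 / 2 : ℝ)
  have ha' : 1 ≤ a' := ha.trans haa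
  set b := β * M with hb
  have hb0 : 0 < b := by positivity
  have hb1 : b ≤ b ^ 2 / c := by
    rw [le_div_iff₀ hc]; nlinarith
  have hb2 : 1 ≤ b ^ 2 / c ^ 2 := by
    rw [le_div_iff₀ (by positivity)]; nlinarith
  have hM2 : M ^ 2 ≤ b ^ 2 * M / c := by
    rw [le_div_iff₀ hc, hb]
    nlinarith [mul_le_mul_of_nonneg_right h2 (sq_nonneg M)]
  have hW : β ^ 2 * M ^ 3 = b ^ 2 * M := by rw [hb]; ring
  -- AM-GM separates M from the confidence term, which is why Λ enters the result without a factor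
  -- of M.
  have hsqrt : 4 * M * √(2 * Λ) ≤ 8 * M ^ 2 + Λ := by
    have := Real.sq_sqrt (by positivity : 0 ≤ 2 * Λ)
    nlinarith [sq_nonneg (4 * M - √(2 * Λ))]
  have hfirst : 6 * (1 + 8 * b) * a * M ≤ 6 * (1 / c ^ 2 + 8 / c) * (a' * (b ^ 2 * M)) := by
    calc 6 * (1 + 8 * b) * a * M ≤ 6 * (b ^ 2 / c ^ 2 + 8 * (b ^ 2 / c)) * a' * M := by gcongr
      _ = _ := by ring
  have hsecond : 8 * M ^ 2 ≤ 8 / c * (a' * (b ^ 2 * M)) := by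
    calc 8 * M ^ 2 ≤ 8 * (1 * (b ^ 2 * M / c)) := by linarith
      _ ≤ 8 * (a' * (b ^ 2 * M / c)) := by gcongr
      _ = _ := by ring
  set C₁ := 6 * (1 / c ^ 2 + 8 / c) + 8 / c with hC₁
  have hC₁0 : 0 ≤ C₁ := by positivity
  have hV : 0 ≤ a' * (b ^ 2 * M) := by positivity
  have hlogle : C₁ ≤ C₁ / Real.log (1 + c) * Real.log N := by
    rw [div_mul_eq_mul_div, le_div_iff₀ hlog]
    exact mul_le_mul_of_nonneg_left hlogN hC₁0
  have hmain := mul_le_mul_of_nonneg_right hlogle hV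
  have hrest : 0 ≤ a' * (b ^ 2 * M) * Real.log N := mul_nonneg hV (hlog.le.trans hlogN)
  have hrest' : 0 ≤ C₁ / Real.log (1 + c) * Λ := by positivity
  have : gapConstant c = C₁ / Real.log (1 + c) + 1 := rfl
  rw [this, mul_assoc a', hW]
  nlinarith

end DecisionCalibration

theorem mainTheorem2 :
    ∀ c : ℝ, 0 < c → ∃ C : ℝ, 0 < C ∧
      ∀ (X Y A H : Type*) [MeasurableSpace X] [MeasurableSpace Y] [Fintype A]
        [NormedAddCommGroup H] [InnerProductSpace ℝ H] [CompleteSpace H]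
        [TopologicalSpace.SeparableSpace H] [MeasurableSpace H] [BorelSpace H] [RKHS ℝ H Y ℝ]
        (D : Measure (X × Y)) [IsProbabilityMeasure D]
        (R₁ R₂ β δ : ℝ) (n : ℕ) (p : X → H),
        0 < R₁ → 0 < R₂ → 0 < β → 0 < δ → δ < 1 →
        Measurable (DecisionCalibration.featureMap H : Y → H) →
        (∀ y : Y, ‖DecisionCalibration.featureMap H y‖ ≤ R₂) →
        Measurable p → (∀ x : X, ‖p x‖ ≤ R₂) →
        c ≤ β * (R₁ * R₂) → c ≤ β ^ 2 * (R₁ * R₂) → 1 + c ≤ R₁ * R₂ * n →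
        ENNReal.ofReal (1 - δ) ≤ (Measure.pi fun _ : Fin n => D)
          {S : Fin n → X × Y |
            ∀ ℓ ∈ DecisionCalibration.lossClass A H R₁,
            ∀ ℓ' ∈ DecisionCalibration.lossClass A H R₁,
              |(∫ z, DecisionCalibration.gap β p ℓ ℓ' z ∂D)
                  - DecisionCalibration.empiricalMean S (DecisionCalibration.gap β p ℓ ℓ')|
                ≤ C * (((Fintype.card A : ℝ) ^ (3 / 2 : ℝ) * β ^ 2 * R₁ ^ 3 * R₂ ^ 3
                      * Real.log (R₁ * R₂ * n) + Real.log (1 / δ)) / √(n : ℝ))} := by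
  open DecisionCalibration in
  intro c hc
  refine ⟨gapConstant c, gapConstant_pos hc, ?_⟩
  intro X Y A H _ _ _ _ _ _ _ _ _ _ D _ R₁ R₂ β δ n p hR₁ hR₂ hβ hδ hδ1 hφm hφ hpm hp h1 h2 h3
  set M := R₁ * R₂ with hM
  have hM0 : 0 < M := by positivity
  have hn : 0 < (n : ℝ) := by
    by_contra h
    nlinarith
  set Λ := Real.log (1 / δ) with hΛ
  have hΛ0 : 0 < Λ := Real.log_pos (by rw [lt_div_iff₀ hδ]; linarith)
  set G := {S : Fin n → X × Y | ∀ ℓ ∈ lossClass A H R₁, ∀ ℓ' ∈ lossClass A H R₁,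
    |(∫ z, gap β p ℓ ℓ' z ∂D) - empiricalMean S (gap β p ℓ ℓ')|
      ≤ gapConstant c * (((Fintype.card A : ℝ) ^ (3 / 2 : ℝ) * β ^ 2 * R₁ ^ 3 * R₂ ^ 3
          * Real.log (M * n) + Λ) / √(n : ℝ))} with hG
  -- For empty A every gap vanishes; otherwise |A| ≥ 1, as the comparison |A| ≤ |A|^(3/2) is derived
  -- from it.
  rcases isEmpty_or_nonempty A with hA | hA
  · have : G = Set.univ := by
      refine Set.eq_univ_of_forall fun S ℓ _ ℓ' _ => ?_
      have := gapConstant_pos hc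
      simp only [gap_eq, empiricalMean, Finset.univ_eq_empty, Finset.sum_empty, integral_zero,
        Finset.sum_const_zero, mul_zero, sub_zero, abs_zero, Fintype.card_eq_zero, Nat.cast_zero]
      rw [Real.zero_rpow (by norm_num)]
      simp only [zero_mul, zero_add]
      positivity
    rw [this, measure_univ]
    exact ENNReal.ofReal_le_one.2 (by linarith)
  -- Chosen so that the McDiarmid tail, with differences 4M, equals exactly δ.
  set ε := 4 * M * √(2 * Λ) * √n with hε
  have hε0 : 0 ≤ ε := by positivity
  have hexp : Real.exp (-ε ^ 2 / (2 * (n * (4 * M) ^ 2))) = δ := by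
    have : -ε ^ 2 / (2 * (n * (4 * M) ^ 2)) = -Λ := by
      rw [hε, mul_pow, mul_pow, Real.sq_sqrt (by positivity), Real.sq_sqrt hn.le]
      field_simp
    rw [this, hΛ, one_div, Real.log_inv, neg_neg, Real.exp_log hδ]
  have hbad := measure_exists_lossClass_deviation_le (A := A) (β := β) D hβ.le hR₁.le hR₂.le hφm hφ
    hpm hp (n := n) hε0
  rw [hexp] at hbad
  have hbound : 6 * (1 + 8 * (β * M)) * Fintype.card A * M + 4 * M * √(2 * Λ)
      ≤ gapConstant c * ((Fintype.card A : ℝ) ^ (3 / 2 : ℝ) * β ^ 2 * R₁ ^ 3 * R₂ ^ 3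
          * Real.log (M * n) + Λ) := by
    have := deviation_arithmetic (a := Fintype.card A) hc hM0 hβ h1 h2 h3 hΛ0.le
      (by exact_mod_cast Fintype.card_pos)
    rwa [show (Fintype.card A : ℝ) ^ (3 / 2 : ℝ) * β ^ 2 * M ^ 3
      = (Fintype.card A : ℝ) ^ (3 / 2 : ℝ) * β ^ 2 * R₁ ^ 3 * R₂ ^ 3 by rw [hM]; ring] at this
  have hone {ℓ ℓ' : A → H} {S : Fin n → X × Y}
      (h : ∑ i, ((∫ z, gap β p ℓ ℓ' z ∂D) - gap β p ℓ ℓ' (S i))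
        ≤ 2 * (3 * (1 + 8 * (β * M)) * Fintype.card A * M * √n) + ε) :
      (∫ z, gap β p ℓ ℓ' z ∂D) - empiricalMean S (gap β p ℓ ℓ')
        ≤ gapConstant c * (((Fintype.card A : ℝ) ^ (3 / 2 : ℝ) * β ^ 2 * R₁ ^ 3 * R₂ ^ 3
          * Real.log (M * n) + Λ) / √(n : ℝ)) := by
    have hs : 0 < √(n : ℝ) := Real.sqrt_pos.2 hn
    have hss : √(n : ℝ) * √n = n := Real.mul_self_sqrt hn.le
    rw [Finset.sum_sub_distrib, Finset.sum_const, Finset.card_univ, Fintype.card_fin,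
      nsmul_eq_mul] at h
    have hmul : ((∫ z, gap β p ℓ ℓ' z ∂D) - empiricalMean S (gap β p ℓ ℓ')) * √n * √n
        ≤ (6 * (1 + 8 * (β * M)) * Fintype.card A * M + 4 * M * √(2 * Λ)) * √n := by
      rw [mul_assoc, hss, empiricalMean, sub_mul, mul_comm (1 / (n : ℝ)), mul_assoc,
        one_div_mul_cancel hn.ne', mul_one]
      linarith
    rw [← mul_div_assoc, le_div_iff₀ hs]
    exact (le_of_mul_le_mul_right hmul hs).trans hbound
  have hcompl : Gᶜ ⊆ {S | ∃ ℓ ∈ lossClass A H R₁, ∃ ℓ' ∈ lossClass A H R₁,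
      2 * (3 * (1 + 8 * (β * M)) * Fintype.card A * M * √n) + ε
        < ∑ i, ((∫ z, gap β p ℓ ℓ' z ∂D) - gap β p ℓ ℓ' (S i))} := by
    intro S hS
    by_contra hcon
    refine hS fun ℓ hℓ ℓ' hℓ' => ?_
    have hall : ∀ ℓ ∈ lossClass A H R₁, (∫ z, gap β p ℓ ℓ' z ∂D) - empiricalMean S (gap β p ℓ ℓ')
        ≤ gapConstant c * (((Fintype.card A : ℝ) ^ (3 / 2 : ℝ) * β ^ 2 * R₁ ^ 3 * R₂ ^ 3
          * Real.log (M * n) + Λ) / √(n : ℝ)) := fun ℓ hℓ =>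
      hone (not_lt.1 fun h => hcon ⟨ℓ, hℓ, ℓ', hℓ', h⟩)
    -- The lower deviation for ℓ is the upper one for -ℓ, which the same event controls, so δ is not
    -- split in two.
    have hneg := hall (-ℓ) fun a => by simpa using hℓ a
    have hfun : gap β p (-ℓ) ℓ' = fun z => -gap β p ℓ ℓ' z := funext fun z => gap_neg ℓ ℓ' z
    rw [hfun, integral_neg, empiricalMean, Finset.sum_neg_distrib] at hneg
    rw [abs_le]
    refine ⟨?_, hall ℓ hℓ⟩
    rw [empiricalMean]
    linarith
  -- Subadditivity suffices here, so measurability of the uncountable intersection G is not needed.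
  have htot : 1 ≤ (Measure.pi fun _ : Fin n => D) G + ENNReal.ofReal δ := by
    calc (1 : ENNReal) = (Measure.pi fun _ : Fin n => D) (G ∪ Gᶜ) := by
          rw [Set.union_compl_self, measure_univ]
      _ ≤ (Measure.pi fun _ : Fin n => D) G + (Measure.pi fun _ : Fin n => D) Gᶜ :=
          measure_union_le _ _
      _ ≤ _ := by gcongr; exact (measure_mono hcompl).trans hbad
  rw [ENNReal.ofReal_sub _ hδ.le, ENNReal.ofReal_one]
  exact tsub_le_iff_right.2 htot
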